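/- For positive integers $s_1,\dots,s_r$ with $s_1>1$ let $$\zeta^\star(s_1,\dots,s_r)=\sum_{k_1\ge\cdots\ge k_r\ge 1}\frac{1}{k_1^{s_1}\cdots k_r^{s_r}},$$ with value $1$ for the empty index ($r=0$), and let $\{a_1,\dots,a_n\}^d$ denote $d$ successive repetitions of the sequence $a_1,\dots,a_n$. Let $m$ be a non-negative integer. Then the series defining $\zeta^\star(\{\{2\}^m,3,\{2\}^m,1\}^d)$ and $\zeta^\star(\{\{2\}^m,3,\{2\}^m,1\}^d,\{2\}^{m+1})$ converge for all $d\ge 0$, and for every complex $z$ with $|z|<1$ both series in $z$ below converge absolutely and $$\sum_{d=0}^{\infty}\zeta^\star(\{\{2\}^m,3,\{2\}^m,1\}^d)\,z^{4(m+1)d}-\sum_{d=0}^{\infty}\zeta^\star(\{\{2\}^m,3,\{2\}^m,1\}^d,\{2\}^{m+1})\,z^{2(m+1)(2d+1)} =-i\prod_{k=0}^{m}\tan\left(\frac{\pi z}{2}\,e^{\frac{\pi i(2k+1)}{2(m+1)}}\right)\cot\left(\frac{\pi z}{2}\,e^{\frac{\pi i k}{m+1}}\right),$$ where at $z=0$ the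 right-hand side, which has a removable singularity there, is understood as its limit as $z\to 0$. -/

import Mathlib

open Filter Topology

/-- The index set of the multiple zeta star sum of depth `r`: tuples `k₁ ≥ ⋯ ≥ k_r ≥ 1`. -/
abbrev StarIndex (r : ℕ) : Type :=
  {k : Fin r → ℕ // Antitone k ∧ ∀ j, 1 ≤ k j}

/-- The summand `1 / (k₁ ^ s₁ ⋯ k_r ^ s_r)`. -/
noncomputable def starTerm (s : List ℕ) (k : StarIndex s.length) : ℝ :=
  ∏ j : Fin s.length, 1 / (k.1 j : ℝ) ^ s.get j

/-- The multiple zeta star value `ζ⋆(s₁, …, s_r)`; the empty index gives the value `1`. -/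
noncomputable def zetaStar (s : List ℕ) : ℝ :=
  ∑' k : StarIndex s.length, starTerm s k

/-- The multi-index `{{2}^m, 3, {2}^m, 1}^d`. -/
def idxA (m d : ℕ) : List ℕ :=
  (List.replicate d (List.replicate m 2 ++ [3] ++ List.replicate m 2 ++ [1])).flatten

/-- The multi-index `{{2}^m, 3, {2}^m, 1}^d, {2}^(m+1)`. -/
def idxB (m d : ℕ) : List ℕ :=
  idxA m d ++ List.replicate (m + 1) 2

/-- The difference of the two generating series. -/
noncomputable def starGenFun (m : ℕ) (z : ℂ) : ℂ :=
  (∑' d : ℕ, (zetaStar (idxA m d) : ℂ) * z ^ (4 * (m + 1) * d)) -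
    ∑' d : ℕ, (zetaStar (idxB m d) : ℂ) * z ^ (2 * (m + 1) * (2 * d + 1))

/-- The product of tangents and cotangents; its formula has a removable singularity at `z = 0`. -/
noncomputable def tanCotProd (m : ℕ) (z : ℂ) : ℂ :=
  -Complex.I * ∏ k ∈ Finset.range (m + 1),
    (Complex.tan ((Real.pi * z / 2) *
        Complex.exp (Real.pi * Complex.I * (2 * k + 1) / (2 * (m + 1)))) *
      Complex.cot ((Real.pi * z / 2) *
        Complex.exp (Real.pi * Complex.I * k / (m + 1))))

/-!
Truncating the outermost variable of `ζ⋆(s₁, …, s_r)` gives the value at the constant sequence `1`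
of a composite of the operators `f ↦ (n ↦ ∑_{j ≤ n} f_j / j ^ s)`. The operator of an entry `2` is
diagonal in the weights `w_k(n) = n!² / ((n - k)! (n + k)!)`, `k ≥ 1`: it divides the coefficient
of `w_k` by `k²`. Summation by parts in `k` evaluates the entries `1` and `3`. Hence, with
`x = z ^ (2(m+1))`, `t_k = (-1) ^ k x / k ^ (2(m+1))` and `P_k = ∏_{j ≤ k} (1 + t_j) / (1 - t_j)`,
the averages `G = ∑_k P_k (w_k - w_{k+1})` satisfy `G = 1 - x S 1 + x² T G`, where `S` and `T` are
the operators of `{2}^{m+1}` and `{2}^m, 3, {2}^m, 1`. Iterating this equation shows that `G` is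
the truncated generating function. Its limit is `∏_k (1 + t_k) / (1 - t_k)`, as each `w_k` tends to
`1`, and this product factors over roots of unity into Euler products of sines and cosines.
-/

section TruncatedSums

variable {K : Type*} [Field K]

/-- The operator `f ↦ (n ↦ ∑_{1 ≤ j ≤ n} f_j / j ^ s)` on sequences indexed by the positive
integers. Throughout, the index `n : ℕ` of a sequence stands for the positive integer `n + 1`. -/
noncomputable def truncOp (K : Type*) [Field K] (s : ℕ) : Module.End K (ℕ → K) where
  toFun f n := ∑ j ∈ Finset.range (n + 1), f j / ((j : K) + 1) ^ s
  map_add' f g := by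
    funext n
    simp only [Pi.add_apply, add_div, Finset.sum_add_distrib]
  map_smul' c f := by
    funext n
    simp only [Pi.smul_apply, smul_eq_mul, mul_div_assoc, Finset.mul_sum, RingHom.id_apply]

theorem truncOp_apply (s : ℕ) (f : ℕ → K) (n : ℕ) :
    truncOp K s f n = ∑ j ∈ Finset.range (n + 1), f j / ((j : K) + 1) ^ s := rfl

theorem truncOp_apply_zero (s : ℕ) (f : ℕ → K) : truncOp K s f 0 = f 0 := by
  simp [truncOp_apply]

theorem truncOp_apply_succ (s : ℕ) (f : ℕ → K) (n : ℕ) :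
    truncOp K s f (n + 1) = truncOp K s f n + f (n + 1) / ((n : K) + 2) ^ s := by
  rw [truncOp_apply, Finset.sum_range_succ, ← truncOp_apply]
  push_cast
  ring

theorem truncOp_eq_truncOp_succ [CharZero K] (s : ℕ) (f : ℕ → K) :
    truncOp K s f = truncOp K (s + 1) fun n => (n + 1) * f n := by
  funext n
  rw [truncOp_apply, truncOp_apply]
  refine Finset.sum_congr rfl fun j _ => ?_
  rw [pow_succ', mul_div_mul_left _ _ (Nat.cast_add_one_ne_zero j)]

/-- The composite of the operators `truncOp` along a multi-index `s`. Its value at the constant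
sequence `1` is the sequence of truncations of `ζ⋆(s)`. -/
noncomputable def starOp (K : Type*) [Field K] (s : List ℕ) : Module.End K (ℕ → K) :=
  (s.map (truncOp K)).prod

theorem starOp_nil (f : ℕ → K) : starOp K [] f = f := rfl

theorem starOp_cons (a : ℕ) (s : List ℕ) (f : ℕ → K) :
    starOp K (a :: s) f = truncOp K a (starOp K s f) := by
  rw [starOp, List.map_cons, List.prod_cons, Module.End.mul_apply, ← starOp]

theorem starOp_append (s t : List ℕ) : starOp K (s ++ t) = starOp K s * starOp K t := by
  rw [starOp, List.map_append, List.prod_append, ← starOp, ← starOp]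

theorem starOp_replicate (r a : ℕ) : starOp K (List.replicate r a) = truncOp K a ^ r := by
  rw [starOp, List.map_replicate, List.prod_replicate]

theorem starOp_flatten_replicate (d : ℕ) (s : List ℕ) :
    starOp K (List.replicate d s).flatten = starOp K s ^ d := by
  induction d with
  | zero => rfl
  | succ d ih => rw [List.replicate_succ, List.flatten_cons, starOp_append, ih, pow_succ']

/-- The repeated block `{2}^m, 3, {2}^m, 1`. -/
def starBlock (m : ℕ) : List ℕ :=
  List.replicate m 2 ++ [3] ++ List.replicate m 2 ++ [1]

theorem starOp_idxA (m d : ℕ) :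
    starOp K (idxA m d) = starOp K (starBlock m) ^ d :=
  starOp_flatten_replicate d (starBlock m)

end TruncatedSums

theorem starOp_one_ofReal (s : List ℕ) (n : ℕ) :
    starOp ℂ s 1 n = (starOp ℝ s 1 n : ℂ) := by
  induction s generalizing n with
  | nil => simp [starOp_nil]
  | cons a s ih => simp [starOp_cons, truncOp_apply, ih]

theorem norm_natCast_add_one (n : ℕ) : ‖(n : ℂ) + 1‖ = n + 1 := by
  exact_mod_cast Complex.norm_natCast (n + 1)

theorem norm_starOp_le (s : List ℕ) (f : ℕ → ℂ) (n : ℕ) :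
    ‖starOp ℂ s f n‖ ≤ starOp ℝ s (fun k => ‖f k‖) n := by
  induction s generalizing n with
  | nil => exact le_rfl
  | cons a s ih =>
    simp only [starOp_cons, truncOp_apply]
    refine norm_sum_le_of_le _ fun j _ => ?_
    rw [norm_div, norm_pow, norm_natCast_add_one]
    gcongr
    exact ih j

section Comparison

variable {K : Type*} [Field K] [LinearOrder K] [IsStrictOrderedRing K]

theorem starOp_nonneg (s : List ℕ) {f : ℕ → K} (hf : 0 ≤ f) : 0 ≤ starOp K s f := by
  induction s with
  | nil => exact hf
  | cons a s ih =>
    intro n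
    rw [starOp_cons, truncOp_apply]
    exact Finset.sum_nonneg fun j _ => div_nonneg (ih j) (by positivity)

theorem starOp_mono (s : List ℕ) : Monotone (starOp K s) :=
  monotone_iff_map_nonneg _ |>.mpr fun _ => starOp_nonneg s

theorem truncOp_mono (s : ℕ) : Monotone (truncOp K s) := by
  simpa [starOp] using starOp_mono (K := K) [s]

theorem truncOp_add_one_mul_le (s : ℕ) {g : ℕ → K} (hg : 0 ≤ g) (n : ℕ) :
    truncOp K s (fun k => (k + 1) * g k) n ≤ (n + 1) * truncOp K s g n := by
  rw [truncOp_apply, truncOp_apply, Finset.mul_sum]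
  refine Finset.sum_le_sum fun j hj => ?_
  have hjn : j ≤ n := Nat.lt_succ_iff.mp (Finset.mem_range.mp hj)
  have hgj : 0 ≤ g j := hg j
  rw [mul_div_assoc]
  gcongr

theorem starOp_le_add_one_mul_starOp (s : List ℕ) {f g : ℕ → K} (hg : 0 ≤ g)
    (hfg : ∀ n, f n ≤ (n + 1) * g n) (n : ℕ) :
    starOp K s f n ≤ (n + 1) * starOp K s g n := by
  induction s generalizing n with
  | nil => exact hfg n
  | cons a s ih =>
    rw [starOp_cons, starOp_cons]
    exact (truncOp_mono a ih n).trans (truncOp_add_one_mul_le a (starOp_nonneg s hg) n)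

/-- The inner variable is the smaller one, so moving a unit of exponent to it decreases the
denominator. -/
theorem starOp_succ_cons_append_le (a b : ℕ) (s : List ℕ) {f : ℕ → K} (hf : 0 ≤ f) :
    starOp K ((a + 1) :: (s ++ [b])) f ≤ starOp K (a :: (s ++ [b + 1])) f := by
  have htail : ∀ n : ℕ, starOp K (s ++ [b]) f n ≤ (n + 1) * starOp K (s ++ [b + 1]) f n := by
    simp only [starOp_append, Module.End.mul_apply, starOp_cons, starOp_nil]
    refine starOp_le_add_one_mul_starOp s ?_ fun n => ?_
    · simpa [starOp] using starOp_nonneg [b + 1] hf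
    · rw [truncOp_eq_truncOp_succ]
      exact truncOp_add_one_mul_le _ hf n
  rw [starOp_cons, starOp_cons, truncOp_eq_truncOp_succ a]
  exact truncOp_mono _ htail

theorem starOp_starBlock_le (m : ℕ) {f : ℕ → K} (hf : 0 ≤ f) :
    starOp K (starBlock m) f ≤ starOp K (List.replicate (2 * m + 2) 2) f := by
  have hsplit : List.replicate (2 * m + 2) 2 =
      List.replicate m 2 ++ (2 :: (List.replicate m 2 ++ [2])) := by
    rw [← List.replicate_succ', ← List.replicate_succ, ← List.replicate_add]
    congr 1
    ring
  rw [hsplit, starBlock, List.append_assoc, List.append_assoc,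
    starOp_append _ ([3] ++ _), starOp_append _ (2 :: _)]
  exact starOp_mono _ (starOp_succ_cons_append_le 2 1 _ hf)

theorem starOp_idxA_le (m d : ℕ) {f : ℕ → K} (hf : 0 ≤ f) :
    starOp K (idxA m d) f ≤ starOp K (List.replicate ((2 * m + 2) * d) 2) f := by
  rw [starOp_idxA, starOp_replicate, pow_mul, ← starOp_replicate]
  induction d with
  | zero => exact le_rfl
  | succ d ih =>
    rw [pow_succ', pow_succ', Module.End.mul_apply, Module.End.mul_apply]
    refine (starOp_mono _ ih).trans (starOp_starBlock_le m ?_)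
    rw [starOp_replicate, ← pow_mul, ← starOp_replicate]
    exact starOp_nonneg _ hf

end Comparison

/-- The sequence `2N / (N + 1)` with `N = n + 1`: a fixed point of `truncOp ℝ 2`, by telescoping. -/
noncomputable def truncTwoFixed (n : ℕ) : ℝ := 2 * (n + 1) / (n + 2)

theorem truncOp_two_truncTwoFixed : truncOp ℝ 2 truncTwoFixed = truncTwoFixed := by
  funext n
  induction n with
  | zero => exact truncOp_apply_zero 2 _
  | succ n ih =>
    rw [truncOp_apply_succ, ih, truncTwoFixed, truncTwoFixed]
    push_cast
    field_simp
    ring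

theorem one_le_truncTwoFixed (n : ℕ) : 1 ≤ truncTwoFixed n := by
  rw [truncTwoFixed, le_div_iff₀ (by positivity)]
  linarith [n.cast_nonneg (α := ℝ)]

theorem truncTwoFixed_le_two (n : ℕ) : truncTwoFixed n ≤ 2 := by
  rw [truncTwoFixed, div_le_iff₀ (by positivity)]
  linarith

theorem starOp_replicate_two_one_le_two (r n : ℕ) : starOp ℝ (List.replicate r 2) 1 n ≤ 2 := by
  have hfixed : starOp ℝ (List.replicate r 2) truncTwoFixed = truncTwoFixed := by
    rw [starOp_replicate, Module.End.pow_apply]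
    exact Function.iterate_fixed truncOp_two_truncTwoFixed r
  calc starOp ℝ (List.replicate r 2) 1 n
      ≤ starOp ℝ (List.replicate r 2) truncTwoFixed n := starOp_mono _ one_le_truncTwoFixed n
    _ = truncTwoFixed n := congrFun hfixed n
    _ ≤ 2 := truncTwoFixed_le_two n

theorem starOp_idxA_one_le_two (m d n : ℕ) : starOp ℝ (idxA m d) 1 n ≤ 2 :=
  (starOp_idxA_le m d zero_le_one n).trans (starOp_replicate_two_one_le_two _ n)

theorem starOp_idxB_one_le_two (m d n : ℕ) : starOp ℝ (idxB m d) 1 n ≤ 2 := by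
  rw [idxB, starOp_append, Module.End.mul_apply]
  refine (starOp_idxA_le m d (starOp_nonneg _ zero_le_one) n).trans ?_
  rw [← Module.End.mul_apply, ← starOp_append, ← List.replicate_add]
  exact starOp_replicate_two_one_le_two _ n

open scoped Classical in
/-- The tuples `N ≥ k₁ ≥ ⋯ ≥ k_r ≥ 1`. -/
noncomputable def antitoneBox (r N : ℕ) : Finset (Fin r → ℕ) :=
  (Fintype.piFinset fun _ => Finset.Icc 1 N).filter Antitone

theorem mem_antitoneBox {r N : ℕ} {k : Fin r → ℕ} :
    k ∈ antitoneBox r N ↔ (∀ i, 1 ≤ k i ∧ k i ≤ N) ∧ Antitone k := by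
  simp [antitoneBox, Fintype.mem_piFinset]

theorem antitone_cons_iff {α : Type*} [Preorder α] {r : ℕ} {a : α} {k : Fin r → α} :
    Antitone (Fin.cons a k : Fin (r + 1) → α) ↔ (∀ i, k i ≤ a) ∧ Antitone k := by
  simp [Antitone, Fin.forall_fin_succ, forall_and]

theorem cons_mem_antitoneBox {r N a : ℕ} {k : Fin r → ℕ} :
    (Fin.cons a k : Fin (r + 1) → ℕ) ∈ antitoneBox (r + 1) N ↔
      (1 ≤ a ∧ a ≤ N) ∧ k ∈ antitoneBox r a := by
  simp only [mem_antitoneBox, antitone_cons_iff, Fin.forall_fin_succ, Fin.cons_zero, Fin.cons_succ]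
  grind

theorem sum_antitoneBox_succ {M : Type*} [AddCommMonoid M] (r N : ℕ) (F : (Fin (r + 1) → ℕ) → M) :
    ∑ k ∈ antitoneBox (r + 1) N, F k =
      ∑ j ∈ Finset.range N, ∑ k ∈ antitoneBox r (j + 1), F (Fin.cons (j + 1) k) := by
  rw [Finset.sum_sigma']
  refine (Finset.sum_bij' (fun p _ => (Fin.cons (p.1 + 1) p.2 : Fin (r + 1) → ℕ))
    (fun k _ => ⟨k 0 - 1, Fin.tail k⟩) ?_ ?_ ?_ ?_ fun _ _ => rfl).symm
  · rintro ⟨j, k⟩ h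
    simp only [Finset.mem_sigma, Finset.mem_range] at h
    exact cons_mem_antitoneBox.mpr ⟨⟨by omega, h.1⟩, h.2⟩
  · intro k h
    rw [← Fin.cons_self_tail k, cons_mem_antitoneBox] at h
    simp only [Finset.mem_sigma, Finset.mem_range, Nat.sub_add_cancel h.1.1]
    exact ⟨by omega, h.2⟩
  · rintro ⟨j, k⟩ _
    simp
  · intro k h
    simp only [Nat.sub_add_cancel ((mem_antitoneBox.mp h).1 0).1, Fin.cons_self_tail]

theorem sum_antitoneBox_eq_starOp (s : List ℕ) (n : ℕ) :
    ∑ k ∈ antitoneBox s.length (n + 1), ∏ j : Fin s.length, 1 / (k j : ℝ) ^ s.get j =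
      starOp ℝ s 1 n := by
  induction s generalizing n with
  | nil => simp [antitoneBox, starOp_nil, Subsingleton.antitone]
  | cons a s ih =>
    rw [starOp_cons, truncOp_apply]
    refine (sum_antitoneBox_succ s.length (n + 1) _).trans (Finset.sum_congr rfl fun j _ => ?_)
    rw [← ih, Finset.sum_div]
    refine Finset.sum_congr rfl fun k _ => (Fin.prod_univ_succ _).trans ?_
    simp only [Fin.cons_zero, Fin.cons_succ, List.get_cons_zero, List.get_cons_succ']
    push_cast
    ring

open scoped Classical in
/-- The indices of the star sum all of whose entries are at most `n + 1`. -/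
noncomputable def starBox (r n : ℕ) : Finset (StarIndex r) :=
  (antitoneBox r (n + 1)).subtype fun k => Antitone k ∧ ∀ j, 1 ≤ k j

theorem mem_starBox {r n : ℕ} {k : StarIndex r} : k ∈ starBox r n ↔ ∀ i, k.1 i ≤ n + 1 := by
  rw [starBox, Finset.mem_subtype, mem_antitoneBox]
  exact ⟨fun h i => (h.1 i).2, fun h => ⟨fun i => ⟨k.2.2 i, h i⟩, k.2.1⟩⟩

theorem sum_starBox_eq_starOp (s : List ℕ) (n : ℕ) :
    ∑ k ∈ starBox s.length n, starTerm s k = starOp ℝ s 1 n := by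
  classical
  rw [← sum_antitoneBox_eq_starOp, starBox]
  exact Finset.sum_subtype_of_mem
    (f := fun k : Fin s.length → ℕ => ∏ j : Fin s.length, 1 / (k j : ℝ) ^ s.get j)
    fun k hk => ⟨(mem_antitoneBox.mp hk).2, fun j => ((mem_antitoneBox.mp hk).1 j).1⟩

theorem tendsto_starBox (r : ℕ) : Tendsto (starBox r) atTop atTop := by
  refine tendsto_atTop_finset_of_monotone (fun a b hab k hk => ?_) fun k => ?_
  · rw [mem_starBox] at hk ⊢
    exact fun i => (hk i).trans (by omega)
  · refine ⟨∑ i, k.1 i, mem_starBox.mpr fun i => Nat.le_succ_of_le ?_⟩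
    exact Finset.single_le_sum (fun _ _ => Nat.zero_le _) (Finset.mem_univ i)

theorem starTerm_nonneg (s : List ℕ) (k : StarIndex s.length) : 0 ≤ starTerm s k :=
  Finset.prod_nonneg fun _ _ => by positivity

theorem summable_starTerm {s : List ℕ} {c : ℝ} (h : ∀ n, starOp ℝ s 1 n ≤ c) :
    Summable (starTerm s) := by
  refine summable_of_sum_le (c := c) (starTerm_nonneg s) fun u => ?_
  obtain ⟨n, hn⟩ := ((tendsto_starBox s.length).eventually (eventually_ge_atTop u)).exists
  calc ∑ k ∈ u, starTerm s k
      ≤ ∑ k ∈ starBox s.length n, starTerm s k :=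
        Finset.sum_le_sum_of_subset_of_nonneg hn fun k _ _ => starTerm_nonneg s k
    _ = starOp ℝ s 1 n := sum_starBox_eq_starOp s n
    _ ≤ c := h n

theorem tendsto_starOp_zetaStar {s : List ℕ} (h : Summable (starTerm s)) :
    Tendsto (starOp ℝ s 1) atTop (𝓝 (zetaStar s)) :=
  (h.hasSum.comp (tendsto_starBox s.length)).congr (sum_starBox_eq_starOp s)

theorem tendsto_starOp_complex_zetaStar {s : List ℕ} (h : Summable (starTerm s)) :
    Tendsto (starOp ℂ s 1) atTop (𝓝 (zetaStar s : ℂ)) := by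
  rw [funext (starOp_one_ofReal s)]
  exact (Complex.continuous_ofReal.tendsto _).comp (tendsto_starOp_zetaStar h)

theorem norm_zetaStar_le {s : List ℕ} {c : ℝ} (h : ∀ n, starOp ℝ s 1 n ≤ c) :
    ‖(zetaStar s : ℂ)‖ ≤ c := by
  rw [Complex.norm_real, zetaStar, Real.norm_of_nonneg (tsum_nonneg (starTerm_nonneg s))]
  exact le_of_tendsto' (tendsto_starOp_zetaStar (summable_starTerm h)) h

theorem summable_starTerm_idxA (m d : ℕ) : Summable (starTerm (idxA m d)) :=
  summable_starTerm (starOp_idxA_one_le_two m d)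

theorem summable_starTerm_idxB (m d : ℕ) : Summable (starTerm (idxB m d)) :=
  summable_starTerm (starOp_idxB_one_le_two m d)

section Weights

variable {K : Type*} [Field K]

/-- The weight `n!² / ((n - k)! (n + k)!)`, the ratio of the binomial coefficients `C(2 n, n - k)`
and `C(2 n, n)`; it vanishes for `k > n`. -/
def centralWeight (K : Type*) [Field K] (n k : ℕ) : K :=
  n.descFactorial k / (n + 1).ascFactorial k

theorem centralWeight_zero (n : ℕ) : centralWeight K n 0 = 1 := by
  simp [centralWeight]

theorem centralWeight_eq_zero {n k : ℕ} (h : n < k) : centralWeight K n k = 0 := by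
  simp [centralWeight, Nat.descFactorial_of_lt h]

theorem natCast_add_one_add_ne_zero [CharZero K] (n k : ℕ) : (n : K) + 1 + k ≠ 0 := by
  exact_mod_cast (by omega : n + 1 + k ≠ 0)

theorem centralWeight_succ [CharZero K] (n k : ℕ) :
    (n + 1 + k) * centralWeight K n (k + 1) = (n - k) * centralWeight K n k := by
  rcases lt_or_ge n k with h | h
  · rw [centralWeight_eq_zero h, centralWeight_eq_zero (h.trans k.lt_succ_self)]
    ring
  · have hne := natCast_add_one_add_ne_zero (K := K) n k
    rw [centralWeight, centralWeight, Nat.descFactorial_succ, Nat.ascFactorial_succ]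
    push_cast [h]
    rw [mul_div_mul_comm]
    field_simp

theorem centralWeight_succ_left [CharZero K] (n k : ℕ) :
    centralWeight K n k * (n + 1) ^ 2 = centralWeight K (n + 1) k * ((n + 1) ^ 2 - k ^ 2) := by
  induction k with
  | zero => simp [centralWeight_zero]
  | succ k ih =>
    have hn := centralWeight_succ (K := K) n k
    have hn' := centralWeight_succ (K := K) (n + 1) k
    apply mul_left_cancel₀ (natCast_add_one_add_ne_zero (K := K) n k)
    push_cast at hn' ⊢
    linear_combination (n + 1 : K) ^ 2 * hn + (n - k : K) * ih -
      ((n : K) + 1 + k) * (n - k) * hn'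

/-- The sum `∑_{1 ≤ k ≤ n} c_k n!² / ((n - k)! (n + k)!)`, as an operator on sequences. Both the
argument and the value follow the convention that the index `n` stands for `n + 1`. -/
def weightSum (K : Type*) [Field K] : Module.End K (ℕ → K) where
  toFun c n := ∑ k ∈ Finset.range (n + 1), c k * centralWeight K (n + 1) (k + 1)
  map_add' c d := by
    funext n
    simp only [Pi.add_apply, add_mul, Finset.sum_add_distrib]
  map_smul' a c := by
    funext n
    simp only [Pi.smul_apply, smul_eq_mul, mul_assoc, Finset.mul_sum, RingHom.id_apply]

theorem weightSum_apply (c : ℕ → K) (n : ℕ) :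
    weightSum K c n = ∑ k ∈ Finset.range (n + 1), c k * centralWeight K (n + 1) (k + 1) := rfl

variable [CharZero K]

theorem truncOp_two_weightSum (c : ℕ → K) :
    truncOp K 2 (weightSum K c) = weightSum K fun k => c k / (k + 1) ^ 2 := by
  funext n
  induction n with
  | zero => simp [truncOp_apply_zero, weightSum_apply]
  | succ n ih =>
    have hextend : weightSum K (fun k => c k / (k + 1) ^ 2) n =
        ∑ k ∈ Finset.range (n + 2), c k / (k + 1) ^ 2 * centralWeight K (n + 1) (k + 1) := by
      rw [Finset.sum_range_succ, centralWeight_eq_zero (Nat.lt_succ_self (n + 1)), mul_zero,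
        add_zero, weightSum_apply]
    rw [truncOp_apply_succ, ih, hextend, weightSum_apply, weightSum_apply, Finset.sum_div,
      ← Finset.sum_add_distrib]
    refine Finset.sum_congr rfl fun k _ => ?_
    have hstep := centralWeight_succ_left (K := K) (n + 1) (k + 1)
    have hk : (k : K) + 1 ≠ 0 := Nat.cast_add_one_ne_zero k
    have hn : (n : K) + 2 ≠ 0 := by exact_mod_cast (n + 1).succ_ne_zero
    push_cast at hstep
    field_simp
    linear_combination c k * hstep

theorem starOp_replicate_two_weightSum (r : ℕ) (c : ℕ → K) :
    starOp K (List.replicate r 2) (weightSum K c) =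
      weightSum K fun k => c k / (k + 1) ^ (2 * r) := by
  induction r with
  | zero => simp [starOp_nil]
  | succ r ih =>
    rw [List.replicate_succ, starOp_cons, ih, truncOp_two_weightSum]
    simp only [div_div, ← pow_add, mul_add_one]

/-- The sequence of averages `∑_{k ≥ 0} E_k (w_k - w_{k + 1})` of `E` with respect to the
differences of the weights `w_k = n!² / ((n - k)! (n + k)!)`, written after summation by parts. -/
def weightAverage (E : ℕ → K) (n : ℕ) : K :=
  E 0 + weightSum K (fun k => E (k + 1) - E k) n

theorem weightSum_add_one_mul_add (E : ℕ → K) :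
    weightSum K (fun k => (k + 1) * (E (k + 1) + E k)) =
      fun n => (n + 1) * weightAverage E n := by
  have hpartial (n N : ℕ) : ∑ k ∈ Finset.range N,
      ((k + 1) * (E (k + 1) + E k) * centralWeight K n (k + 1) -
        n * ((E (k + 1) - E k) * centralWeight K n (k + 1))) =
      n * E 0 - E N * ((n - N) * centralWeight K n N) := by
    induction N with
    | zero => simp [centralWeight_zero, mul_comm]
    | succ N ih =>
      rw [Finset.sum_range_succ, ih]
      push_cast
      linear_combination E N * centralWeight_succ (K := K) n N
  funext n
  have hfull := hpartial (n + 1) (n + 1)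
  rw [sub_self, zero_mul, mul_zero, sub_zero, Finset.sum_sub_distrib, ← Finset.mul_sum,
    ← weightSum_apply, ← weightSum_apply] at hfull
  rw [weightAverage]
  push_cast at hfull
  linear_combination hfull

theorem truncOp_weightAverage (s : ℕ) (E : ℕ → K) :
    truncOp K s (weightAverage E) =
      truncOp K (s + 1) (weightSum K fun k => (k + 1) * (E (k + 1) + E k)) := by
  rw [truncOp_eq_truncOp_succ, weightSum_add_one_mul_add]

theorem truncOp_one_weightAverage (E : ℕ → K) :
    truncOp K 1 (weightAverage E) = weightSum K fun k => (E (k + 1) + E k) / (k + 1) := by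
  rw [truncOp_weightAverage, truncOp_two_weightSum]
  congr 1
  funext k
  have hk : (k : K) + 1 ≠ 0 := Nat.cast_add_one_ne_zero k
  field_simp

theorem truncOp_three_weightSum {E : ℕ → K} (hE : E 0 = 0) :
    truncOp K 3 (weightSum K fun k => (k + 1) * (E (k + 1) + E k)) =
      weightSum K fun k => (E (k + 1) - E k) / (k + 1) ^ 2 := by
  rw [← truncOp_weightAverage, ← truncOp_two_weightSum]
  congr 1
  funext n
  rw [weightAverage, hE, zero_add]

theorem weightSum_two_mul_neg_one_pow : weightSum K (fun k => 2 * (-1) ^ k) = 1 := by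
  have hzero := weightSum_add_one_mul_add fun k : ℕ => -(-1 : K) ^ k
  have hcancel (k : ℕ) : -(-1 : K) ^ (k + 1) + -(-1) ^ k = 0 := by ring
  have hdiff (k : ℕ) : -(-1 : K) ^ (k + 1) - -(-1) ^ k = 2 * (-1) ^ k := by ring
  simp only [weightAverage, hcancel, hdiff, mul_zero] at hzero
  funext n
  have hn := congrFun hzero n
  rw [show (fun _ : ℕ => (0 : K)) = 0 from rfl, map_zero, Pi.zero_apply, eq_comm, mul_eq_zero,
    or_iff_right (Nat.cast_add_one_ne_zero n), pow_zero, neg_add_eq_zero] at hn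
  exact hn.symm

theorem starOp_replicate_two_one (r : ℕ) :
    starOp K (List.replicate r 2) 1 = weightSum K fun k => 2 * (-1) ^ k / (k + 1) ^ (2 * r) := by
  rw [← weightSum_two_mul_neg_one_pow, starOp_replicate_two_weightSum]

end Weights

section CayleyProduct

variable {K : Type*} [Field K]

/-- The partial products of the Cayley transforms `(1 + t_k) / (1 - t_k)`. -/
def cayleyProd (t : ℕ → K) (n : ℕ) : K :=
  ∏ k ∈ Finset.range n, (1 + t k) / (1 - t k)

theorem cayleyProd_zero (t : ℕ → K) : cayleyProd t 0 = 1 := rfl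

theorem cayleyProd_succ_sub {t : ℕ → K} {k : ℕ} (hk : t k ≠ 1) :
    cayleyProd t (k + 1) - cayleyProd t k = t k * (cayleyProd t (k + 1) + cayleyProd t k) := by
  have hne : 1 - t k ≠ 0 := sub_ne_zero.mpr hk.symm
  rw [cayleyProd, Finset.prod_range_succ, ← cayleyProd]
  field_simp
  ring

/-- The term `(-1)^k x / k^{2(m+1)}`, where `k : ℕ` stands for `k + 1`. -/
def altTerm (m : ℕ) (x : K) (k : ℕ) : K :=
  (-1) ^ (k + 1) * (x / (k + 1) ^ (2 * (m + 1)))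

theorem starOp_starBlock (m : ℕ) (f : ℕ → K) :
    starOp K (starBlock m) f = starOp K (List.replicate m 2)
      (truncOp K 3 (starOp K (List.replicate m 2) (truncOp K 1 f))) := by
  simp only [starBlock, starOp_append, Module.End.mul_apply, starOp_cons, starOp_nil]

variable [CharZero K]

theorem smul_starOp_starBlock_weightAverage {m : ℕ} {x : K} {P : ℕ → K} (hP0 : P 0 = 1)
    (hP : ∀ k, P (k + 1) - P k = altTerm m x k * (P (k + 1) + P k)) :
    x • starOp K (starBlock m) (weightAverage P) =
      weightSum K fun k => (-1) ^ (k + 1) * (P (k + 1) + P k - 2) / (k + 1) ^ (2 * (m + 1)) := by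
  -- The sign exchanges sums and differences of consecutive terms, so that `truncOp K 3` can be
  -- evaluated by summation by parts against `E`.
  set E : ℕ → K := fun k => (-1) ^ k * (P k - 1) with hE
  have hsum (k : ℕ) : x * ((P (k + 1) + P k) / (k + 1) / (k + 1) ^ (2 * m)) =
      (k + 1) * (E (k + 1) + E k) := by
    have hk : (k : K) + 1 ≠ 0 := Nat.cast_add_one_ne_zero k
    have hsign : (-1 : K) ^ (k + 1) * (-1) ^ (k + 1) = 1 := by rw [← mul_pow]; simp
    have hEP : E (k + 1) + E k = (-1) ^ (k + 1) * (P (k + 1) - P k) := by simp only [hE]; ring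
    have hexp : (k + 1 : K) ^ (2 * (m + 1)) = (k + 1) ^ (2 * m) * (k + 1) ^ 2 := by ring
    rw [hEP, hP, altTerm, ← mul_assoc ((-1 : K) ^ (k + 1)), ← mul_assoc ((-1 : K) ^ (k + 1)),
      hsign, hexp]
    field_simp
  have hdiff (k : ℕ) : E (k + 1) - E k = (-1) ^ (k + 1) * (P (k + 1) + P k - 2) := by
    simp only [hE]; ring
  rw [starOp_starBlock, truncOp_one_weightAverage, starOp_replicate_two_weightSum,
    ← map_smul, ← map_smul, ← map_smul]
  have hinner : (x • fun k : ℕ => (P (k + 1) + P k) / ((k : K) + 1) / (k + 1) ^ (2 * m)) =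
      fun k : ℕ => (k + 1) * (E (k + 1) + E k) := funext hsum
  rw [hinner, truncOp_three_weightSum (by simp [hE, hP0]), starOp_replicate_two_weightSum]
  simp only [hdiff, div_div, ← pow_add, mul_add_one, add_comm 2]

theorem weightAverage_eq_add_smul_starOp {m : ℕ} {x : K} {P : ℕ → K} (hP0 : P 0 = 1)
    (hP : ∀ k, P (k + 1) - P k = altTerm m x k * (P (k + 1) + P k)) :
    weightAverage P = (1 - x • starOp K (List.replicate (m + 1) 2) 1) +
      x ^ 2 • starOp K (starBlock m) (weightAverage P) := by
  have hsplit : (fun k => P (k + 1) - P k) =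
      x • (fun k : ℕ => (-1) ^ (k + 1) * (P (k + 1) + P k - 2) / ((k : K) + 1) ^ (2 * (m + 1))) -
        x • fun k : ℕ => 2 * (-1) ^ k / ((k : K) + 1) ^ (2 * (m + 1)) := by
    funext k
    simp only [Pi.sub_apply, Pi.smul_apply, smul_eq_mul, hP, altTerm]
    ring
  rw [pow_two, mul_smul, smul_starOp_starBlock_weightAverage hP0 hP, starOp_replicate_two_one]
  funext n
  rw [weightAverage, hP0, hsplit, map_sub, map_smul, map_smul]
  simp only [Pi.add_apply, Pi.sub_apply, Pi.one_apply]
  ring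

end CayleyProduct

theorem eq_sum_range_add_of_eq_add_smul {R M : Type*} [CommRing R] [AddCommGroup M] [Module R M]
    {T : Module.End R M} {y : R} {f g : M} (h : g = f + y • T g) (N : ℕ) :
    g = ∑ d ∈ Finset.range N, y ^ d • (T ^ d) f + y ^ N • (T ^ N) g := by
  induction N with
  | zero => simp
  | succ N ih =>
    have hstep : (T ^ N) g = (T ^ N) f + y • (T ^ (N + 1)) g := by
      conv_lhs => rw [h]
      rw [map_add, map_smul, pow_succ, Module.End.mul_apply]
    rw [Finset.sum_range_succ, add_assoc, pow_succ y, mul_smul, ← smul_add, ← hstep]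
    exact ih

section Limits

theorem norm_centralWeight_le_one (n k : ℕ) : ‖centralWeight ℂ n k‖ ≤ 1 := by
  have hle : n.descFactorial k ≤ (n + 1).ascFactorial k :=
    (n.descFactorial_le_pow k).trans <|
      (Nat.pow_le_pow_left n.le_succ k).trans (Nat.pow_succ_le_ascFactorial (n + 1) k)
  rw [centralWeight, norm_div, Complex.norm_natCast, Complex.norm_natCast]
  exact div_le_one_of_le₀ (by exact_mod_cast hle) (Nat.cast_nonneg _)

theorem tendsto_centralWeight (k : ℕ) :
    Tendsto (fun n => centralWeight ℂ n k) atTop (𝓝 1) := by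
  induction k with
  | zero => simp only [centralWeight_zero, tendsto_const_nhds]
  | succ k ih =>
    have hratio := tendsto_add_mul_div_add_mul_atTop_nhds (-k : ℂ) (1 + k) 1 one_ne_zero
    have hmul := hratio.mul ih
    rw [div_one, one_mul] at hmul
    refine hmul.congr fun n => ?_
    have hden : 1 + (k : ℂ) + 1 * n ≠ 0 := by
      convert natCast_add_one_add_ne_zero (K := ℂ) n k using 1
      ring
    rw [div_mul_eq_mul_div, div_eq_iff hden]
    linear_combination -centralWeight_succ (K := ℂ) n k

theorem tendsto_weightSum {c : ℕ → ℂ} (hc : Summable fun k => ‖c k‖) :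
    Tendsto (weightSum ℂ c) atTop (𝓝 (∑' k, c k)) := by
  have htsum (n : ℕ) : ∑' k, c k * centralWeight ℂ (n + 1) (k + 1) = weightSum ℂ c n := by
    refine tsum_eq_sum (s := Finset.range (n + 1)) fun k hk => ?_
    rw [centralWeight_eq_zero (by simpa using hk), mul_zero]
  refine Tendsto.congr htsum <|
    tendsto_tsum_of_dominated_convergence hc (fun k => ?_) (.of_forall fun n k => ?_)
  · simpa using (((tendsto_centralWeight (k + 1)).comp (tendsto_add_atTop_nat 1)).const_mul (c k))
  · rw [norm_mul]
    exact mul_le_of_le_one_right (norm_nonneg _) (norm_centralWeight_le_one _ _)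

theorem tendsto_weightAverage {E : ℕ → ℂ} {p : ℂ} (hE : Summable fun k => ‖E (k + 1) - E k‖)
    (hp : Tendsto E atTop (𝓝 p)) : Tendsto (weightAverage E) atTop (𝓝 p) := by
  have htsum : E 0 + ∑' k, (E (k + 1) - E k) = p := by
    refine tendsto_nhds_unique (hE.of_norm.hasSum.tendsto_sum_nat.const_add (E 0)) ?_
    simpa only [Finset.sum_range_sub, add_sub_cancel] using hp
  rw [← htsum]
  exact (tendsto_weightSum hE).const_add (E 0)

theorem summable_norm_cayleyProd_sub {t : ℕ → ℂ} {p : ℂ} (ht : Summable fun k => ‖t k‖)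
    (ht1 : ∀ k, t k ≠ 1) (hp : Tendsto (cayleyProd t) atTop (𝓝 p)) :
    Summable fun k => ‖cayleyProd t (k + 1) - cayleyProd t k‖ := by
  have hbounded : (fun k => cayleyProd t (k + 1) + cayleyProd t k) =O[atTop] fun _ => (1 : ℂ) :=
    ((hp.comp (tendsto_add_atTop_nat 1)).add hp).isBigO_one ℂ
  have hprod := (Asymptotics.isBigO_refl t atTop).mul hbounded
  simp only [← cayleyProd_succ_sub (ht1 _), mul_one] at hprod
  exact summable_of_isBigO_nat ht (hprod.norm_left.norm_right)

theorem norm_altTerm (m : ℕ) (x : ℂ) (k : ℕ) :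
    ‖altTerm m x k‖ = ‖x‖ / (k + 1) ^ (2 * (m + 1)) := by
  rw [altTerm, norm_mul, norm_div, norm_pow, norm_pow, norm_neg, norm_one, one_pow, one_mul,
    norm_natCast_add_one]

theorem altTerm_ne_one {x : ℂ} (hx : ‖x‖ < 1) (m k : ℕ) : altTerm m x k ≠ 1 := by
  refine fun h => (h ▸ norm_altTerm m x k).not_gt ?_
  rw [norm_one]
  refine (div_le_self (norm_nonneg x) (one_le_pow₀ ?_)).trans_lt hx
  exact le_add_of_nonneg_left k.cast_nonneg

theorem summable_norm_altTerm (m : ℕ) (x : ℂ) : Summable fun k => ‖altTerm m x k‖ := by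
  have hpow : Summable fun k : ℕ => 1 / ((k + 1 : ℕ) : ℝ) ^ (2 * (m + 1)) :=
    (summable_nat_add_iff 1).mpr (Real.summable_one_div_nat_pow.mpr (by omega))
  refine (hpow.mul_left ‖x‖).congr fun k => ?_
  rw [norm_altTerm, mul_one_div, Nat.cast_succ]

theorem tendsto_weightAverage_cayleyProd_altTerm {m : ℕ} {x p : ℂ} (hx : ‖x‖ < 1)
    (hp : Tendsto (cayleyProd (altTerm m x)) atTop (𝓝 p)) :
    Tendsto (weightAverage (cayleyProd (altTerm m x))) atTop (𝓝 p) :=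
  tendsto_weightAverage
    (summable_norm_cayleyProd_sub (summable_norm_altTerm m x) (altTerm_ne_one hx m) hp) hp

theorem norm_starOp_idxA_le {f : ℕ → ℂ} {c : ℝ} (hf : ∀ n, ‖f n‖ ≤ c) (m d n : ℕ) :
    ‖starOp ℂ (idxA m d) f n‖ ≤ c * 2 := by
  have hc : 0 ≤ c := (norm_nonneg _).trans (hf 0)
  calc ‖starOp ℂ (idxA m d) f n‖
      ≤ starOp ℝ (idxA m d) (fun k => ‖f k‖) n := norm_starOp_le _ f n
    _ ≤ starOp ℝ (idxA m d) (c • 1) n := starOp_mono _ (fun k => by simpa using hf k) n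
    _ = c * starOp ℝ (idxA m d) 1 n := by rw [map_smul, Pi.smul_apply, smul_eq_mul]
    _ ≤ c * 2 := mul_le_mul_of_nonneg_left (starOp_idxA_one_le_two m d n) hc

theorem weightAverage_cayleyProd_altTerm_eq {m : ℕ} {x : ℂ} (hx : ‖x‖ < 1) (N n : ℕ) :
    weightAverage (cayleyProd (altTerm m x)) n =
      ∑ d ∈ Finset.range N, (x ^ 2) ^ d *
        (starOp ℂ (idxA m d) 1 n - x * starOp ℂ (idxB m d) 1 n) +
      (x ^ 2) ^ N * starOp ℂ (idxA m N) (weightAverage (cayleyProd (altTerm m x))) n := by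
  have hfixed := weightAverage_eq_add_smul_starOp (cayleyProd_zero (altTerm m x)) fun k =>
    cayleyProd_succ_sub (altTerm_ne_one hx m k)
  have hn := congrFun (eq_sum_range_add_of_eq_add_smul hfixed N) n
  simpa only [idxB, starOp_append, ← starOp_idxA, map_sub, map_smul, Module.End.mul_apply,
    Pi.add_apply, Finset.sum_apply, Pi.smul_apply, Pi.sub_apply, smul_eq_mul] using hn

theorem norm_pow_lt_one {𝕜 : Type*} [NormedField 𝕜] {z : 𝕜} (hz : ‖z‖ < 1) {k : ℕ}
    (hk : k ≠ 0) : ‖z ^ k‖ < 1 := by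
  rw [norm_pow]
  exact pow_lt_one₀ (norm_nonneg z) hz hk

theorem tendsto_sum_range_zetaStar {m : ℕ} {x p : ℂ} (hx : ‖x‖ < 1)
    (hp : Tendsto (cayleyProd (altTerm m x)) atTop (𝓝 p)) :
    Tendsto (fun N => ∑ d ∈ Finset.range N, (x ^ 2) ^ d *
      ((zetaStar (idxA m d) : ℂ) - x * zetaStar (idxB m d))) atTop (𝓝 p) := by
  set G := weightAverage (cayleyProd (altTerm m x))
  have hG : Tendsto G atTop (𝓝 p) := tendsto_weightAverage_cayleyProd_altTerm hx hp
  obtain ⟨c, hc⟩ := hG.norm.bddAbove_range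
  have hGc (n : ℕ) : ‖G n‖ ≤ c := hc ⟨n, rfl⟩
  have hA (d : ℕ) := tendsto_starOp_complex_zetaStar (summable_starTerm_idxA m d)
  have hB (d : ℕ) := tendsto_starOp_complex_zetaStar (summable_starTerm_idxB m d)
  have hremainder (N : ℕ) : ‖p - ∑ d ∈ Finset.range N, (x ^ 2) ^ d *
      ((zetaStar (idxA m d) : ℂ) - x * zetaStar (idxB m d))‖ ≤ ‖x ^ 2‖ ^ N * (c * 2) := by
    refine le_of_tendsto' (hG.sub <| tendsto_finsetSum _ fun d _ =>
      ((hA d).sub ((hB d).const_mul x)).const_mul ((x ^ 2) ^ d)).norm fun n => ?_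
    rw [sub_eq_of_eq_add' (weightAverage_cayleyProd_altTerm_eq hx N n), norm_mul, norm_pow]
    exact mul_le_mul_of_nonneg_left (norm_starOp_idxA_le hGc m N n) (by positivity)
  have hzero := (tendsto_pow_atTop_nhds_zero_of_lt_one (norm_nonneg _)
    (norm_pow_lt_one hx two_ne_zero)).mul_const (c * 2)
  rw [zero_mul] at hzero
  simpa using (squeeze_zero_norm hremainder hzero).const_sub p

end Limits

section GeneratingFunction

theorem norm_mul_pow_le {𝕜 : Type*} [NormedField 𝕜] {a : ℕ → 𝕜} {c r : ℝ} {w : 𝕜}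
    (ha : ∀ d, ‖a d‖ ≤ c) (hw : ‖w‖ ≤ r) (d : ℕ) : ‖a d * w ^ d‖ ≤ c * r ^ d := by
  have hc : 0 ≤ c := (norm_nonneg _).trans (ha d)
  rw [norm_mul, norm_pow]
  gcongr
  exact ha d

theorem summable_mul_pow_of_norm_le {𝕜 : Type*} [NormedField 𝕜] [CompleteSpace 𝕜] {a : ℕ → 𝕜}
    {c : ℝ} {w : 𝕜} (ha : ∀ d, ‖a d‖ ≤ c) (hw : ‖w‖ < 1) : Summable fun d => a d * w ^ d :=
  .of_norm_bounded ((summable_geometric_of_lt_one (norm_nonneg w) hw).mul_left c)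
    (norm_mul_pow_le ha le_rfl)

theorem continuousAt_tsum_mul_pow_zero {𝕜 : Type*} [NormedField 𝕜] [CompleteSpace 𝕜] {a : ℕ → 𝕜}
    {c : ℝ} (ha : ∀ d, ‖a d‖ ≤ c) : ContinuousAt (fun w => ∑' d, a d * w ^ d) 0 := by
  have hbound : Summable fun d : ℕ => c * (1 / 2 : ℝ) ^ d := summable_geometric_two.mul_left c
  refine ContinuousOn.continuousAt (s := Metric.closedBall 0 (1 / 2))
    (continuousOn_tsum (fun d => by fun_prop) hbound fun d w hw => ?_)
    (Metric.closedBall_mem_nhds 0 one_half_pos)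
  exact norm_mul_pow_le ha (mem_closedBall_zero_iff.mp hw) d

theorem norm_zetaStar_idxA_le_two (m d : ℕ) : ‖(zetaStar (idxA m d) : ℂ)‖ ≤ 2 :=
  norm_zetaStar_le (starOp_idxA_one_le_two m d)

theorem norm_zetaStar_idxB_le_two (m d : ℕ) : ‖(zetaStar (idxB m d) : ℂ)‖ ≤ 2 :=
  norm_zetaStar_le (starOp_idxB_one_le_two m d)

theorem pow_two_mul_mul_two_mul_add_one {M : Type*} [Monoid M] (z : M) (m d : ℕ) :
    z ^ (2 * (m + 1) * (2 * d + 1)) = z ^ (2 * (m + 1)) * (z ^ (4 * (m + 1))) ^ d := by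
  rw [← pow_mul, ← pow_add]
  congr 1
  ring

theorem summable_zetaStar_idxA_mul_pow (m : ℕ) {z : ℂ} (hz : ‖z‖ < 1) :
    Summable fun d : ℕ => (zetaStar (idxA m d) : ℂ) * z ^ (4 * (m + 1) * d) := by
  simp only [pow_mul z (4 * (m + 1))]
  exact summable_mul_pow_of_norm_le (norm_zetaStar_idxA_le_two m) (norm_pow_lt_one hz (by simp))

theorem summable_zetaStar_idxB_mul_pow (m : ℕ) {z : ℂ} (hz : ‖z‖ < 1) :
    Summable fun d : ℕ => (zetaStar (idxB m d) : ℂ) * z ^ (2 * (m + 1) * (2 * d + 1)) := by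
  simp only [pow_two_mul_mul_two_mul_add_one, mul_left_comm _ (z ^ (2 * (m + 1)))]
  exact (summable_mul_pow_of_norm_le (norm_zetaStar_idxB_le_two m)
    (norm_pow_lt_one hz (by simp))).mul_left _

theorem starGenFun_eq_of_tendsto {m : ℕ} {z p : ℂ} (hz : ‖z‖ < 1)
    (hp : Tendsto (cayleyProd (altTerm m (z ^ (2 * (m + 1))))) atTop (𝓝 p)) :
    starGenFun m z = p := by
  have hsum := (summable_zetaStar_idxA_mul_pow m hz).hasSum.sub
    (summable_zetaStar_idxB_mul_pow m hz).hasSum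
  refine tendsto_nhds_unique hsum.tendsto_sum_nat
    ((tendsto_sum_range_zetaStar (norm_pow_lt_one hz (by simp)) hp).congr fun N => ?_)
  refine Finset.sum_congr rfl fun d _ => ?_
  ring

theorem continuousAt_starGenFun_zero (m : ℕ) : ContinuousAt (starGenFun m) 0 := by
  have hpow {k : ℕ} (hk : k ≠ 0) {F : ℂ → ℂ} (hF : ContinuousAt F 0) :
      ContinuousAt (fun z => F (z ^ k)) 0 :=
    ContinuousAt.comp (g := F) (by rwa [zero_pow hk]) (continuous_pow k).continuousAt
  have hA := hpow (k := 4 * (m + 1)) (by simp)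
    (continuousAt_tsum_mul_pow_zero (norm_zetaStar_idxA_le_two m))
  have hB := hpow (k := 4 * (m + 1)) (by simp)
    (continuousAt_tsum_mul_pow_zero (norm_zetaStar_idxB_le_two m))
  have hfun : starGenFun m = fun z =>
      ∑' d, (zetaStar (idxA m d) : ℂ) * (z ^ (4 * (m + 1))) ^ d -
        z ^ (2 * (m + 1)) * ∑' d, (zetaStar (idxB m d) : ℂ) * (z ^ (4 * (m + 1))) ^ d := by
    funext z
    simp only [starGenFun, pow_two_mul_mul_two_mul_add_one, pow_mul z (4 * (m + 1)),
      mul_left_comm _ (z ^ (2 * (m + 1))), tsum_mul_left]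
  rw [hfun]
  exact hA.sub ((continuous_pow (2 * (m + 1))).continuousAt.mul hB)

end GeneratingFunction

section EulerProducts

theorem mem_integerComplement_of_norm_lt_one {w : ℂ} (hw0 : w ≠ 0) (hw : ‖w‖ < 1) :
    w ∈ Complex.integerComplement := by
  rintro ⟨k, rfl⟩
  rw [Complex.norm_intCast] at hw
  have hk : k = 0 := Int.abs_lt_one_iff.mp (by exact_mod_cast hw)
  exact hw0 (by rw [hk, Int.cast_zero])

theorem div_two_mem_integerComplement {w : ℂ} (hw : w ∈ Complex.integerComplement) :
    w / 2 ∈ Complex.integerComplement := by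
  rintro ⟨k, hk⟩
  exact hw ⟨2 * k, by rw [Int.cast_mul, hk, Int.cast_ofNat, mul_div_cancel₀ _ two_ne_zero]⟩

theorem hasProd_sin_pi_mul_div {w : ℂ} (hw : w ∈ Complex.integerComplement) :
    HasProd (fun j : ℕ => 1 - w ^ 2 / ((j : ℂ) + 1) ^ 2)
      (Complex.sin (Real.pi * w) / (Real.pi * w)) := by
  rw [← euler_sineTerm_tprod hw]
  simpa only [sineTerm, neg_div, ← sub_eq_add_neg] using (multipliable_sineTerm w).hasProd

theorem multipliable_one_sub_sq_div_odd (w : ℂ) :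
    Multipliable fun j : ℕ => 1 - w ^ 2 / (2 * (j : ℂ) + 1) ^ 2 := by
  have hsum := (summable_pow_div_add (w ^ 2) 2 1 one_lt_two).comp_injective
    (mul_right_injective₀ (two_ne_zero (α := ℕ)))
  simp only [sub_eq_add_neg]
  refine multipliable_one_add_of_summable ?_
  simpa [Function.comp_def] using hsum

theorem sin_pi_mul_div_two_ne_zero {w : ℂ} (hw : w ∈ Complex.integerComplement) :
    Complex.sin (Real.pi * w / 2) ≠ 0 := by
  simpa only [mul_div_assoc] using sin_pi_mul_ne_zero (div_two_mem_integerComplement hw)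

theorem cos_pi_mul_div_two_ne_zero {w : ℂ} (hw : w ∈ Complex.integerComplement) :
    Complex.cos (Real.pi * w / 2) ≠ 0 := by
  have hsin := sin_pi_mul_ne_zero hw
  rw [← mul_div_cancel₀ (Real.pi * w) (two_ne_zero (α := ℂ)), Complex.sin_two_mul] at hsin
  exact right_ne_zero_of_mul hsin

theorem hasProd_cos_pi_mul_div_two {w : ℂ} (hw : w ∈ Complex.integerComplement) :
    HasProd (fun j : ℕ => 1 - w ^ 2 / (2 * (j : ℂ) + 1) ^ 2) (Complex.cos (Real.pi * w / 2)) := by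
  have hw2 := div_two_mem_integerComplement hw
  have hsin := sin_pi_mul_div_two_ne_zero hw
  -- Every second factor of the product for `sin (π w)` belongs to the product for `sin (π w / 2)`.
  set f : ℕ → ℂ := fun j => 1 - w ^ 2 / ((j : ℂ) + 1) ^ 2
  have heven : (fun j => f (2 * j)) = fun j : ℕ => 1 - w ^ 2 / (2 * (j : ℂ) + 1) ^ 2 := by
    funext j
    simp only [f, Nat.cast_mul, Nat.cast_ofNat]
  have hodd : (fun j => f (2 * j + 1)) = fun j : ℕ => 1 - (w / 2) ^ 2 / ((j : ℂ) + 1) ^ 2 := by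
    funext j
    simp only [f, ← div_pow, div_div]
    push_cast
    ring_nf
  have heven_prod := (multipliable_one_sub_sq_div_odd w).hasProd
  have hodd_prod := hasProd_sin_pi_mul_div hw2
  rw [← heven] at heven_prod
  rw [← hodd] at hodd_prod
  have hsplit := (heven_prod.even_mul_odd hodd_prod).unique (hasProd_sin_pi_mul_div hw)
  have hcos : ∏' j, f (2 * j) = Complex.cos (Real.pi * w / 2) := by
    have hw0 := Complex.integerComplement.ne_zero hw
    have hpi : (Real.pi : ℂ) ≠ 0 := Complex.ofReal_ne_zero.mpr Real.pi_ne_zero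
    rw [← mul_div_assoc, ← mul_div_cancel₀ (Real.pi * w) (two_ne_zero (α := ℂ)),
      Complex.sin_two_mul] at hsplit
    field_simp at hsplit
    exact hsplit
  rwa [← heven, ← hcos]

end EulerProducts

section RootsOfUnity

/-- The `2(m+1)`-th root of unity in the argument of the `k`-th cotangent of `tanCotProd`. -/
noncomputable def cotRoot (m k : ℕ) : ℂ :=
  Complex.exp (Real.pi * Complex.I * k / (m + 1))

/-- The `2(m+1)`-th root of `-1` in the argument of the `k`-th tangent of `tanCotProd`. -/
noncomputable def tanRoot (m k : ℕ) : ℂ :=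
  Complex.exp (Real.pi * Complex.I * (2 * k + 1) / (2 * (m + 1)))

theorem cotRoot_ne_zero (m k : ℕ) : cotRoot m k ≠ 0 := Complex.exp_ne_zero _

theorem norm_cotRoot (m k : ℕ) : ‖cotRoot m k‖ = 1 := by
  rw [cotRoot]
  convert Complex.norm_exp_ofReal_mul_I (Real.pi * k / (m + 1)) using 3
  push_cast
  ring

theorem norm_tanRoot (m k : ℕ) : ‖tanRoot m k‖ = 1 := by
  rw [tanRoot]
  convert Complex.norm_exp_ofReal_mul_I (Real.pi * (2 * k + 1) / (2 * (m + 1))) using 3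
  push_cast
  ring

theorem tanRoot_eq_mul_cotRoot (m k : ℕ) : tanRoot m k = tanRoot m 0 * cotRoot m k := by
  rw [tanRoot, tanRoot, cotRoot, ← Complex.exp_add]
  congr 1
  field_simp
  push_cast
  ring

theorem tanRoot_zero_pow (m : ℕ) : tanRoot m 0 ^ (m + 1) = Complex.I := by
  have hm : (m : ℂ) + 1 ≠ 0 := Nat.cast_add_one_ne_zero m
  rw [tanRoot, ← Complex.exp_nat_mul]
  convert Complex.exp_pi_div_two_mul_I using 2
  push_cast
  field_simp
  ring

theorem prod_cotRoot_div_tanRoot (m : ℕ) :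
    ∏ k ∈ Finset.range (m + 1), cotRoot m k / tanRoot m k = -Complex.I := by
  have hdiv (k : ℕ) : cotRoot m k / tanRoot m k = (tanRoot m 0)⁻¹ := by
    rw [tanRoot_eq_mul_cotRoot, div_mul_cancel_right₀ (cotRoot_ne_zero m k)]
  simp only [hdiv, Finset.prod_const, Finset.card_range, inv_pow, tanRoot_zero_pow, Complex.inv_I]

theorem prod_one_sub_mul_cotRoot_sq (m : ℕ) (y : ℂ) :
    ∏ k ∈ Finset.range (m + 1), (1 - y * cotRoot m k ^ 2) = 1 - y ^ (m + 1) := by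
  have hfactor := congrArg (Polynomial.eval 1) (X_pow_sub_C_eq_prod
    (Complex.isPrimitiveRoot_exp (m + 1) m.succ_ne_zero) m.succ_pos (rfl : y ^ (m + 1) = _))
  simp only [Polynomial.eval_prod, Polynomial.eval_sub, Polynomial.eval_pow, Polynomial.eval_X,
    Polynomial.eval_C, one_pow] at hfactor
  rw [hfactor]
  refine Finset.prod_congr rfl fun k _ => ?_
  rw [mul_comm, cotRoot, ← Complex.exp_nat_mul, ← Complex.exp_nat_mul]
  congr 3
  push_cast
  ring

theorem prod_one_sub_mul_tanRoot_sq (m : ℕ) (y : ℂ) :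
    ∏ k ∈ Finset.range (m + 1), (1 - y * tanRoot m k ^ 2) = 1 + y ^ (m + 1) := by
  have hshift := prod_one_sub_mul_cotRoot_sq m (y * tanRoot m 0 ^ 2)
  rw [mul_pow, pow_right_comm, tanRoot_zero_pow, Complex.I_sq, mul_neg_one, sub_neg_eq_add]
    at hshift
  rw [← hshift]
  refine Finset.prod_congr rfl fun k _ => ?_
  rw [tanRoot_eq_mul_cotRoot m k, mul_pow, mul_assoc]

theorem prod_one_sub_sq_mul_cotRoot_div (m : ℕ) (z c : ℂ) :
    ∏ k ∈ Finset.range (m + 1), (1 - (z * cotRoot m k) ^ 2 / c ^ 2) =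
      1 - z ^ (2 * (m + 1)) / c ^ (2 * (m + 1)) := by
  simp only [mul_pow, mul_div_right_comm, prod_one_sub_mul_cotRoot_sq, div_pow, pow_mul]

theorem prod_one_sub_sq_mul_tanRoot_div (m : ℕ) (z c : ℂ) :
    ∏ k ∈ Finset.range (m + 1), (1 - (z * tanRoot m k) ^ 2 / c ^ 2) =
      1 + z ^ (2 * (m + 1)) / c ^ (2 * (m + 1)) := by
  simp only [mul_pow, mul_div_right_comm, prod_one_sub_mul_tanRoot_sq, div_pow, pow_mul]

end RootsOfUnity

section Evaluation

theorem altTerm_two_mul (m : ℕ) (x : ℂ) (j : ℕ) :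
    altTerm m x (2 * j) = -(x / (2 * j + 1) ^ (2 * (m + 1))) := by
  rw [altTerm, pow_succ, pow_mul]
  push_cast
  norm_num

theorem altTerm_two_mul_add_one (m : ℕ) (z : ℂ) (j : ℕ) :
    altTerm m (z ^ (2 * (m + 1))) (2 * j + 1) =
      (z / 2) ^ (2 * (m + 1)) / (j + 1) ^ (2 * (m + 1)) := by
  have hsign : (-1 : ℂ) ^ (2 * j + 1 + 1) = 1 := Even.neg_one_pow ⟨j + 1, by ring⟩
  rw [altTerm, hsign, one_mul, ← div_pow, ← div_pow, div_div]
  push_cast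
  ring_nf

variable {m : ℕ} {z : ℂ}

theorem mul_mem_integerComplement (hz : ‖z‖ < 1) (hz0 : z ≠ 0) {ω : ℂ} (hω : ‖ω‖ = 1) :
    z * ω ∈ Complex.integerComplement := by
  refine mem_integerComplement_of_norm_lt_one (mul_ne_zero hz0 ?_) ?_
  · exact norm_ne_zero_iff.mp (hω ▸ one_ne_zero)
  · rwa [norm_mul, hω, mul_one]

theorem hasProd_cayley_even (hz : ‖z‖ < 1) (hz0 : z ≠ 0) :
    HasProd (fun j => (1 + altTerm m (z ^ (2 * (m + 1))) (2 * j)) /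
        (1 - altTerm m (z ^ (2 * (m + 1))) (2 * j)))
      (∏ k ∈ Finset.range (m + 1), Complex.cos (Real.pi * z / 2 * cotRoot m k) /
        Complex.cos (Real.pi * z / 2 * tanRoot m k)) := by
  have hcot (k : ℕ) := mul_mem_integerComplement hz hz0 (norm_cotRoot m k)
  have htan (k : ℕ) := mul_mem_integerComplement hz hz0 (norm_tanRoot m k)
  have hprod := hasProd_prod (s := Finset.range (m + 1)) fun k _ =>
    (hasProd_cos_pi_mul_div_two (hcot k)).div₀ (hasProd_cos_pi_mul_div_two (htan k))
      (cos_pi_mul_div_two_ne_zero (htan k))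
  simpa only [Finset.prod_div_distrib, prod_one_sub_sq_mul_cotRoot_div,
    prod_one_sub_sq_mul_tanRoot_div, altTerm_two_mul, sub_neg_eq_add, ← sub_eq_add_neg,
    ← mul_assoc, mul_div_right_comm] using hprod

theorem hasProd_sin_pi_mul_div_two_mul (hz : ‖z‖ < 1) (hz0 : z ≠ 0) {ω : ℂ} (hω : ‖ω‖ = 1) :
    HasProd (fun j : ℕ => 1 - (z / 2 * ω) ^ 2 / ((j : ℂ) + 1) ^ 2)
      (Complex.sin (Real.pi * z / 2 * ω) / (Real.pi * z / 2 * ω)) := by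
  have hmem := div_two_mem_integerComplement (mul_mem_integerComplement hz hz0 hω)
  have harg : Real.pi * (z * ω / 2) = Real.pi * z / 2 * ω := by ring
  rw [div_mul_eq_mul_div z, ← harg]
  exact hasProd_sin_pi_mul_div hmem

theorem hasProd_cayley_odd (hz : ‖z‖ < 1) (hz0 : z ≠ 0) :
    HasProd (fun j => (1 + altTerm m (z ^ (2 * (m + 1))) (2 * j + 1)) /
        (1 - altTerm m (z ^ (2 * (m + 1))) (2 * j + 1)))
      (∏ k ∈ Finset.range (m + 1), cotRoot m k / tanRoot m k *
        (Complex.sin (Real.pi * z / 2 * tanRoot m k) /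
          Complex.sin (Real.pi * z / 2 * cotRoot m k))) := by
  have hc : Real.pi * z / 2 ≠ 0 :=
    div_ne_zero (mul_ne_zero (Complex.ofReal_ne_zero.mpr Real.pi_ne_zero) hz0) two_ne_zero
  have hne (k : ℕ) : Complex.sin (Real.pi * z / 2 * cotRoot m k) /
      (Real.pi * z / 2 * cotRoot m k) ≠ 0 := by
    have hsin := sin_pi_mul_div_two_ne_zero (mul_mem_integerComplement hz hz0 (norm_cotRoot m k))
    rw [← mul_assoc, mul_div_right_comm] at hsin
    exact div_ne_zero hsin (mul_ne_zero hc (cotRoot_ne_zero m k))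
  have hprod := hasProd_prod (s := Finset.range (m + 1)) fun k _ =>
    (hasProd_sin_pi_mul_div_two_mul hz hz0 (norm_tanRoot m k)).div₀
      (hasProd_sin_pi_mul_div_two_mul hz hz0 (norm_cotRoot m k)) (hne k)
  have hquot (k : ℕ) :
      Complex.sin (Real.pi * z / 2 * tanRoot m k) / (Real.pi * z / 2 * tanRoot m k) /
        (Complex.sin (Real.pi * z / 2 * cotRoot m k) / (Real.pi * z / 2 * cotRoot m k)) =
      cotRoot m k / tanRoot m k * (Complex.sin (Real.pi * z / 2 * tanRoot m k) /
        Complex.sin (Real.pi * z / 2 * cotRoot m k)) := by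
    rw [div_div_div_comm, mul_div_mul_left _ _ hc, div_div_eq_mul_div]
    ring
  simpa only [hquot, Finset.prod_div_distrib, prod_one_sub_sq_mul_cotRoot_div,
    prod_one_sub_sq_mul_tanRoot_div, altTerm_two_mul_add_one] using hprod

theorem tendsto_cayleyProd_tanCotProd (hz : ‖z‖ < 1) (hz0 : z ≠ 0) :
    Tendsto (cayleyProd (altTerm m (z ^ (2 * (m + 1))))) atTop (𝓝 (tanCotProd m z)) := by
  have hvalue : (∏ k ∈ Finset.range (m + 1), Complex.cos (Real.pi * z / 2 * cotRoot m k) /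
        Complex.cos (Real.pi * z / 2 * tanRoot m k)) *
      ∏ k ∈ Finset.range (m + 1), cotRoot m k / tanRoot m k *
        (Complex.sin (Real.pi * z / 2 * tanRoot m k) /
          Complex.sin (Real.pi * z / 2 * cotRoot m k)) = tanCotProd m z := by
    rw [tanCotProd, ← prod_cotRoot_div_tanRoot, ← Finset.prod_mul_distrib,
      ← Finset.prod_mul_distrib]
    refine Finset.prod_congr rfl fun k _ => ?_
    rw [← cotRoot, ← tanRoot, Complex.tan_eq_sin_div_cos, Complex.cot_eq_cos_div_sin]
    ring
  rw [← hvalue]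
  exact (HasProd.even_mul_odd
    (f := fun k => (1 + altTerm m (z ^ (2 * (m + 1))) k) / (1 - altTerm m (z ^ (2 * (m + 1))) k))
    (hasProd_cayley_even hz hz0) (hasProd_cayley_odd hz hz0)).tendsto_prod_nat

end Evaluation

theorem starGenFun_eq_tanCotProd (m : ℕ) {z : ℂ} (hz : ‖z‖ < 1) (hz0 : z ≠ 0) :
    starGenFun m z = tanCotProd m z :=
  starGenFun_eq_of_tendsto hz (tendsto_cayleyProd_tanCotProd hz hz0)

theorem theorem3p2 (m : ℕ) :
    (∀ d : ℕ, Summable (starTerm (idxA m d)) ∧ Summable (starTerm (idxB m d))) ∧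
    (∀ z : ℂ, ‖z‖ < 1 →
      Summable (fun d : ℕ => (zetaStar (idxA m d) : ℂ) * z ^ (4 * (m + 1) * d)) ∧
      Summable (fun d : ℕ => (zetaStar (idxB m d) : ℂ) * z ^ (2 * (m + 1) * (2 * d + 1))) ∧
      (z ≠ 0 → starGenFun m z = tanCotProd m z)) ∧
    Tendsto (tanCotProd m) (𝓝[≠] 0) (𝓝 (starGenFun m 0)) := by
  refine ⟨fun d => ⟨summable_starTerm_idxA m d, summable_starTerm_idxB m d⟩,
    fun z hz => ⟨summable_zetaStar_idxA_mul_pow m hz, summable_zetaStar_idxB_mul_pow m hz,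
      starGenFun_eq_tanCotProd m hz⟩, ?_⟩
  refine ((continuousAt_starGenFun_zero m).tendsto.mono_left nhdsWithin_le_nhds).congr' ?_
  filter_upwards [self_mem_nhdsWithin,
    nhdsWithin_le_nhds (Metric.ball_mem_nhds (0 : ℂ) one_pos)] with z hz0 hz
  exact starGenFun_eq_tanCotProd m (by simpa using hz) hz0
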